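/- Let $n\ge 1$ and let $N$ (impressions) and $V$ (ads) be finite sets with $|N|=|V|=n$; write $[k]=\{1,\dots,k\}$ for an integer $k \ge 0$. Consider i.i.d. online bipartite matching with $n$ stages, counted down from $n$ to $1$: in each stage an impression drawn uniformly and independently from $N$ appears and is irrevocably matched to a remaining ad or discarded, each ad being matched at most once. Let $Q\subseteq\mathbb R^{N\times V\times[n]}$ be the polyhedron of achievable matching probabilities, i.e. the set of all $z=(z_{ij}^t)$ with $$z_{ij}^t=\sum_{S\subseteq V\setminus\{j\},\ |S|+1\ge t}x_{i,j}^{t,S}\qquad(i\in N,\ j\in V,\ t\in[n])$$ for some $x,y\ge 0$ satisfying $$\sum_{j\in V}x_{i,j}^{n,V\setminus\{j\}}+y_i^{n,V}\le\tfrac1n\qquad(i\in N),$$ $$\sum_{j\in S}x_{i,j}^{t,S\setminus\{j\}}+y_i^{t,S}\,1_{\{t\ne1\}}-\tfrac1n 1_{\{|S|>t\}}\sum_{k\in N}y_k^{t+1,S}-\tfrac1n\sum_{k\in N}\sum_{j\in V\setminus S}x_{k,j}^{t+1,S}\le0$$ for all $t\in[n-1]$, $i\in N$, $\emptyset\ne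 S\subsetneq V$ with $|S|\ge t$, and $$\sum_{j\in V}x_{i,j}^{t,V\setminus\{j\}}+y_i^{t,V}\,1_{\{t\ne1\}}-\tfrac1n\sum_{k\in N}y_k^{t+1,V}\le0\qquad(t\in[n-1],\ i\in N).$$ (Here $x_{i,j}^{t,S}$ is the probability that $i$ is matched to $j$ in stage $t$ while $S\cup\{j\}$ is the set of available ads, and $y_i^{t,S}$ the probability that $i$ is discarded in stage $t$ while $S$ is available.) For $I\subseteq N$, $J\subseteq V$ put $Z_{I,J}^t=\sum_{i\in I}\sum_{j\in J}z_{ij}^t$, and identify a singleton with its element. **Theorem.** Let $J\subseteq V$ with $|J|=h\in[n-1]$, let $I\subseteq N$ with $|I|=r\in[n-1]$, where $h\ge2$ or $r=1$, let $t\in[n-h]$, and let $i_t,\dots,i_{t+h-2}\in N$ (repetitions allowed; no impressions if $h=1$). Then the inequality $$r\sum_{\tau=t+h}^{n}Z_{N,J}^{\tau}+n\,Z_{I,J}^{t+h-1}+\sum_{\tau=t}^{t+h-2}n^{t+h-\tau}Z_{i_\tau,J}^{\tau}\ \le\ r+\sum_{\tau=1}^{h-1}n^{\tau}$$ is facet-defining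 for $Q$: it holds for every $z\in Q$, and the set of $z\in Q$ satisfying it with equality is non-empty and has affine dimension $\dim Q-1$. -/

import Mathlib

open Finset

namespace OBM

/-- The stages `[n] = {1, …, n}`, counted down: stage `n` is the first one, stage `1` the last. -/
abbrev Stage (n : ℕ) : Type := {t : ℕ // t ∈ Finset.Icc 1 n}

/-- The space `ℝ^(N × V × [n])` of vectors `z`, with coordinates `z i j t`. -/
abbrev MatchSpace (N V : Type*) (n : ℕ) : Type _ := N → V → Stage n → ℝ

section Polytope

variable {N V : Type*} [Fintype N] [Fintype V] [DecidableEq V]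

/-- Feasibility for the linear program over policies. `x i j t S` is the probability of matching
impression `i` to ad `j` in stage `t` when the available set of ads is `S ∪ {j}`, with `j ∉ S`;
`y i t S` is the probability of discarding `i` in stage `t` when the available set is `S`.
Entries at an index which is not a state of the process (`j ∈ S`, or fewer than `t` ads available
in stage `t`) do not occur in any of the constraints below other than nonnegativity. -/
structure IsPolicy (n : ℕ) (x : N → V → ℕ → Finset V → ℝ) (y : N → ℕ → Finset V → ℝ) : Prop where
  x_nonneg : ∀ i j t S, 0 ≤ x i j t S
  y_nonneg : ∀ i t S, 0 ≤ y i t S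
  first : ∀ i, ∑ j, x i j n (univ \ {j}) + y i n univ ≤ 1 / (n : ℝ)
  flow : ∀ t ∈ Finset.Icc 1 (n - 1), ∀ i, ∀ S : Finset V, S.Nonempty → S ≠ univ → t ≤ #S →
    ∑ j ∈ S, x i j t (S \ {j}) + (if t ≠ 1 then y i t S else 0)
      - 1 / (n : ℝ) * (if t < #S then ∑ k, y k (t + 1) S else 0)
      - 1 / (n : ℝ) * ∑ k, ∑ j ∈ univ \ S, x k j (t + 1) S ≤ 0
  flow_univ : ∀ t ∈ Finset.Icc 1 (n - 1), ∀ i,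
    ∑ j, x i j t (univ \ {j}) + (if t ≠ 1 then y i t univ else 0)
      - 1 / (n : ℝ) * ∑ k, y k (t + 1) univ ≤ 0

/-- The polyhedron `Q` of achievable matching probabilities: the projection
`z i j t = ∑ x i j t S`, over the sets `S ⊆ V \ {j}` such that `S ∪ {j}` can be the set of
available ads in stage `t` (at most one ad is used per stage, so at least `t` ads are left). -/
def Q (N V : Type*) [Fintype N] [Fintype V] [DecidableEq V] (n : ℕ) : Set (MatchSpace N V n) :=
  {z | ∃ (x : N → V → ℕ → Finset V → ℝ) (y : N → ℕ → Finset V → ℝ), IsPolicy n x y ∧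
    ∀ i j (t : Stage n),
      z i j t = ∑ S ∈ (univ \ {j} : Finset V).powerset with (t : ℕ) ≤ #S + 1, x i j t S}

end Polytope

/-- `Z_{I,J}^τ = ∑_{i ∈ I} ∑_{j ∈ J} z_{ij}^τ` for a stage `τ ∈ [n]` (and `0` for other `τ`). -/
def Z {N V : Type*} {n : ℕ} (z : MatchSpace N V n) (I : Finset N) (J : Finset V) (τ : ℕ) : ℝ :=
  if hτ : τ ∈ Finset.Icc 1 n then ∑ i ∈ I, ∑ j ∈ J, z i j ⟨τ, hτ⟩ else 0

/-- The inequality `f z ≤ b` is facet-defining for `P`: it is valid for `P`, and the face of `P`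
on which equality holds is nonempty and of dimension `dim P - 1`. -/
def IsFacetDefining {E : Type*} [AddCommGroup E] [Module ℝ E] (P : Set E) (f : E → ℝ) (b : ℝ) :
    Prop :=
  (∀ z ∈ P, f z ≤ b) ∧ {z ∈ P | f z = b}.Nonempty ∧
    Module.finrank ℝ (vectorSpan ℝ {z ∈ P | f z = b}) + 1 = Module.finrank ℝ (vectorSpan ℝ P)

end OBM

/-! Read the left side as the expected reward of a policy that is paid `coeff` for each match. In a
stage τ = t + m with 0 ≤ m < h, an impression of `M τ` matched into J pays n^(h-m); in a stage τ ≥ t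
+ h every match into J pays r. The expected pay |M τ| n^(h-m) / n of such a middle stage is
`marginal` at m + 1, and these numbers decrease: n^(h-1) ≥ … ≥ n ≥ r. With k ads of J left, the best
reward from stage τ on is the sum of the first min(τ + 1 - t, k) of them (`optValue`). Because they
decrease, this solves the Bellman inequalities (`coeff_add_optValue_le`, `optValue_eq_average`), so
weak duality (`pairing_le_of_bellman`) gives validity.

For the dimension, every policy that uses only optimal actions lies on the face. If a functional c
is constant on the face, changing one action at one reachable state shows that tied optimal actions
are tied for c as well (`reward_add_value_eq`). Subtract a multiple of `coeff` so that c vanishes at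
one coordinate (t, i₁, j₀) with i₁ ∈ `M t` and j₀ ∈ J. Going up from stage 1, once c vanishes below
the current stage, a tie between matching and discarding kills a coefficient. Such ties occur at
reachable states for all coordinates except those with i ∈ `M t` and j ∈ J in stage t; there a tie
between two ads of J is used (`coeff_eq_zero`). Hence c is a multiple of `coeff`. The zero
objective, for which all actions tie, shows in the same way that Q is full-dimensional, and
`isFacetDefining_of_dual` counts dimensions. -/

set_option linter.unusedSectionVars false

namespace OBM

/-! ### Weak duality for the policy linear program -/

section Duality

variable {N V : Type*} [Fintype N] [Fintype V] [DecidableEq V]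

/-- The matching probabilities of `x`, for an arbitrary natural number as the stage. -/
def matchProb (x : N → V → ℕ → Finset V → ℝ) (i : N) (j : V) (τ : ℕ) : ℝ :=
  ∑ S ∈ (univ \ {j} : Finset V).powerset with τ ≤ #S + 1, x i j τ S

/-- The probability of being in state `S` at stage `τ`, as given by the decisions `x`, `y` at the
preceding stage. -/
def inflow (n : ℕ) (x : N → V → ℕ → Finset V → ℝ) (y : N → ℕ → Finset V → ℝ) (τ : ℕ)
    (S : Finset V) : ℝ :=
  if τ = n then (if S = univ then 1 else 0) else
    (if τ < #S then ∑ k, y k (τ + 1) S else 0) + ∑ k, ∑ j ∈ univ \ S, x k j (τ + 1) S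

/-- The linear functional on `MatchSpace` with coefficients `c τ i j`. -/
def pairing (n : ℕ) (c : ℕ → N → V → ℝ) : MatchSpace N V n →ₗ[ℝ] ℝ where
  toFun z := ∑ τ : Stage n, ∑ i, ∑ j, c τ i j * z i j τ
  map_add' z w := by simp [mul_add, sum_add_distrib]
  map_smul' a z := by simp [mul_sum, mul_left_comm]

theorem pairing_apply (n : ℕ) (c : ℕ → N → V → ℝ) (z : MatchSpace N V n) :
    pairing n c z = ∑ τ : Stage n, ∑ i, ∑ j, c τ i j * z i j τ := rfl

theorem sum_stage (n : ℕ) (f : ℕ → ℝ) :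
    ∑ τ : Stage n, f τ = ∑ τ ∈ range n, f (τ + 1) := by
  rw [Finset.sum_coe_sort (Finset.Icc 1 n) f, Finset.range_eq_Ico, Finset.sum_Ico_add' f 0 n 1]
  rfl

/-- Reindexes by the state before the match, S ∪ {j}, so that sums over decisions become sums over
states. -/
theorem sum_compl_singleton_powerset (j : V) (τ : ℕ) (F : Finset V → ℝ) :
    ∑ S ∈ (univ \ {j} : Finset V).powerset with τ ≤ #S + 1, F S
      = ∑ S with τ ≤ #S, if j ∈ S then F (S.erase j) else 0 := by
  rw [← Finset.sum_filter, Finset.filter_filter]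
  refine Finset.sum_nbij' (fun S => insert j S) (fun S => S.erase j) ?_ ?_ ?_ ?_ ?_
  · intro S hS
    simp only [mem_filter, mem_powerset, subset_sdiff, disjoint_singleton_right] at hS
    simp [card_insert_of_notMem hS.1.2, hS.2]
  · intro S hS
    simp only [mem_filter, mem_univ, true_and] at hS
    simp only [mem_filter, mem_powerset, subset_sdiff, disjoint_singleton_right]
    have := Finset.card_erase_add_one hS.2
    refine ⟨⟨subset_univ _, notMem_erase j S⟩, by omega⟩
  · intro S hS
    simp only [mem_filter, mem_powerset, subset_sdiff, disjoint_singleton_right] at hS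
    exact erase_insert hS.1.2
  · intro S hS
    simp only [mem_filter, mem_univ, true_and] at hS
    exact insert_erase hS.2
  · intro S hS
    simp only [mem_filter, mem_powerset, subset_sdiff, disjoint_singleton_right] at hS
    rw [erase_insert hS.1.2]

/-- Each transition that uses up one ad is counted once by its target and once by its source. -/
theorem sum_notMem_eq_sum_erase (τ : ℕ) (F : V → Finset V → ℝ) :
    ∑ S : Finset V with τ ≤ #S, ∑ j ∈ univ \ S, F j S
      = ∑ S : Finset V with τ + 1 ≤ #S, ∑ j ∈ S, F j (S.erase j) := by
  have h1 : ∀ S : Finset V, ∑ j ∈ univ \ S, F j S = ∑ j, if j ∈ S then 0 else F j S := by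
    intro S
    simp_rw [← ite_not (_ ∈ S) (F _ S) 0]
    rw [← sum_filter]
    congr 1
    ext j; simp
  have h2 : ∀ S : Finset V, ∑ j ∈ S, F j (S.erase j)
      = ∑ j, if j ∈ S then F j (S.erase j) else 0 := by
    intro S
    rw [← sum_filter]
    congr 1
    ext j; simp
  simp_rw [h1, h2]
  rw [sum_comm]
  conv_rhs => rw [sum_comm]
  refine sum_congr rfl fun j _ => ?_
  rw [← sum_compl_singleton_powerset j (τ + 1) (F j)]
  simp_rw [← ite_not (j ∈ _) (F j _) 0]
  rw [← sum_filter, filter_filter]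
  congr 1
  ext S
  simp [subset_sdiff, and_comm]

theorem sum_mul_matchProb (x : N → V → ℕ → Finset V → ℝ) (c : N → V → ℝ) (τ : ℕ) :
    ∑ i, ∑ j, c i j * matchProb x i j τ
      = ∑ S : Finset V with τ ≤ #S, ∑ i, ∑ j ∈ S, x i j τ (S.erase j) * c i j := by
  simp_rw [matchProb, sum_compl_singleton_powerset]
  conv_rhs => rw [sum_comm]
  refine sum_congr rfl fun i _ => ?_
  simp_rw [mul_sum]
  rw [sum_comm]
  refine sum_congr rfl fun S _ => ?_
  simp_rw [mul_ite, mul_zero]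
  rw [← sum_filter]
  refine sum_congr (by ext; simp) fun j _ => mul_comm _ _

theorem sum_inflow_mul {n τ : ℕ} (hτ : τ < n) (x : N → V → ℕ → Finset V → ℝ)
    (y : N → ℕ → Finset V → ℝ) (W : Finset V → ℝ) :
    ∑ S : Finset V with τ ≤ #S, inflow n x y τ S * W S
      = ∑ S : Finset V with τ + 1 ≤ #S, ∑ i, (y i (τ + 1) S * W S
          + ∑ j ∈ S, x i j (τ + 1) (S.erase j) * W (S.erase j)) := by
  simp_rw [inflow, if_neg hτ.ne, add_mul, sum_add_distrib]
  congr 1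
  · simp_rw [ite_mul, zero_mul, sum_mul]
    rw [← sum_filter, filter_filter]
    refine sum_congr ?_ fun _ _ => rfl
    ext S
    simp only [mem_filter, mem_univ, true_and]
    omega
  · have := sum_notMem_eq_sum_erase τ (fun j S => (∑ k, x k j (τ + 1) S) * W S)
    simp_rw [sum_mul] at this ⊢
    calc _ = ∑ S : Finset V with τ ≤ #S, ∑ j ∈ univ \ S, ∑ k, x k j (τ + 1) S * W S := by
          exact sum_congr rfl fun S _ => sum_comm
      _ = _ := this
      _ = _ := sum_congr rfl fun S _ => sum_comm

/-- The total reward of `x` telescopes along the stages, for every choice of a potential `W`. -/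
theorem pairing_matchProb (n : ℕ) (x : N → V → ℕ → Finset V → ℝ)
    (y : N → ℕ → Finset V → ℝ) (c : ℕ → N → V → ℝ) (W : ℕ → Finset V → ℝ) (hW : ∀ S, W 0 S = 0)
    (hV : Fintype.card V = n) :
    pairing n c (fun i j t => matchProb x i j t)
      = W n univ + ∑ τ ∈ range n, (∑ S : Finset V with τ + 1 ≤ #S,
        ((∑ i, (y i (τ + 1) S * W τ S
          + ∑ j ∈ S, x i j (τ + 1) (S.erase j) * (c (τ + 1) i j + W τ (S.erase j))))
          - inflow n x y (τ + 1) S * W (τ + 1) S)) := by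
  -- The expected potential on entering stage τ; its increments telescope between `W 0 = 0` and the
  -- certain initial state.
  set Φ : ℕ → ℝ := fun τ => ∑ S : Finset V with τ ≤ #S, inflow n x y τ S * W τ S with hΦ
  have h0 : Φ 0 = 0 := by simp [hΦ, hW]
  have hn : Φ n = W n univ := by
    simp only [hΦ, inflow, if_true, ite_mul, one_mul, zero_mul]
    rw [Finset.sum_ite_eq']
    simp [hV]
  rw [pairing_apply,
    sum_stage n (fun τ => ∑ i, ∑ j, c τ i j * matchProb x i j τ)]
  have key : ∀ τ ∈ range n, ∑ i, ∑ j, c (τ + 1) i j * matchProb x i j (τ + 1)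
      = (∑ S : Finset V with τ + 1 ≤ #S,
        ((∑ i, (y i (τ + 1) S * W τ S
          + ∑ j ∈ S, x i j (τ + 1) (S.erase j) * (c (τ + 1) i j + W τ (S.erase j))))
          - inflow n x y (τ + 1) S * W (τ + 1) S)) + (Φ (τ + 1) - Φ τ) := by
    intro τ hτ
    rw [sum_mul_matchProb]
    have h1 := sum_inflow_mul (mem_range.1 hτ) x y (W τ)
    simp only [hΦ]
    rw [h1, sum_sub_distrib]
    simp_rw [mul_add, sum_add_distrib]
    ring
  rw [sum_congr rfl key, sum_add_distrib, sum_range_sub, hn, h0]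
  ring

/-- The three families of constraints are one: an impression, having probability 1/n, cannot be
acted upon more often than it meets the state. -/
theorem IsPolicy.sum_le_inflow {n : ℕ} {x : N → V → ℕ → Finset V → ℝ}
    {y : N → ℕ → Finset V → ℝ} (h : IsPolicy n x y) (hV : Fintype.card V = n) {τ : ℕ}
    (hτ : τ < n) (i : N) {S : Finset V} (hS : τ + 1 ≤ #S) :
    ∑ j ∈ S, x i j (τ + 1) (S.erase j) + (if τ ≠ 0 then y i (τ + 1) S else 0)
      ≤ 1 / (n : ℝ) * inflow n x y (τ + 1) S := by
  have hSn : #S ≤ n := hV ▸ card_le_univ S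
  simp_rw [← sdiff_singleton_eq_erase]
  rcases Nat.lt_or_ge (τ + 1) n with hlt | hge
  · rw [inflow, if_neg hlt.ne]
    have ht : τ + 1 ∈ Finset.Icc 1 (n - 1) := by rw [Finset.mem_Icc]; omega
    by_cases hu : S = univ
    · have := h.flow_univ (τ + 1) ht i
      subst hu
      have hc : τ + 1 < #(univ : Finset V) := by rw [card_univ, hV]; exact hlt
      rw [if_pos hc]
      rw [show (univ \ univ : Finset V) = ∅ by simp]
      simp only [sum_empty, sum_const_zero, add_zero]
      simp only [ne_eq, Nat.add_eq_right] at this ⊢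
      linarith
    · have := h.flow (τ + 1) ht i S (card_pos.1 (by omega)) hu hS
      simp only [ne_eq, Nat.add_eq_right] at this ⊢
      rw [mul_add]
      linarith
  · have hn : τ + 1 = n := by omega
    have hu : S = univ := by
      rw [← card_eq_iff_eq_univ, hV]; omega
    have h1 := h.first i
    rw [inflow, if_pos hn, if_pos hu, hn, mul_one]
    subst hu
    have h2 := h.y_nonneg i n univ
    split_ifs <;> linarith

/-- Weak duality: a solution of the Bellman inequalities bounds the reward of every policy. -/
theorem pairing_le_of_bellman {n : ℕ} (hV : Fintype.card V = n)
    {a : ℕ → N → V → ℝ} {W : ℕ → Finset V → ℝ} {U : ℕ → Finset V → N → ℝ}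
    (hW : ∀ S, W 0 S = 0) (hU : ∀ τ S i, 0 ≤ U τ S i)
    (hmatch : ∀ τ S i, ∀ j ∈ S, a (τ + 1) i j + W τ (S.erase j) ≤ U (τ + 1) S i)
    (hdiscard : ∀ τ S i, W τ S ≤ U (τ + 1) S i)
    (havg : ∀ τ S, W (τ + 1) S = 1 / (n : ℝ) * ∑ i, U (τ + 1) S i)
    {z : MatchSpace N V n} (hz : z ∈ Q N V n) : pairing n a z ≤ W n univ := by
  obtain ⟨x, y, hxy, hz⟩ := hz
  obtain rfl : z = fun i j (t : Stage n) => matchProb x i j t := by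
    funext i j t; exact hz i j t
  rw [pairing_matchProb n x y a W hW hV, add_le_iff_nonpos_right]
  refine sum_nonpos fun τ hτ => sum_nonpos fun S hS => ?_
  have hS' : τ + 1 ≤ #S := by simpa using hS
  rw [havg, sub_nonpos, mul_sum, mul_sum]
  refine sum_le_sum fun i _ => ?_
  have h1 := mul_le_mul_of_nonneg_right
    (hxy.sum_le_inflow hV (mem_range.1 hτ) i hS') (hU (τ + 1) S i)
  -- Discarding in stage 1 is left unbounded by the constraints, which is harmless because `W 0 =
  -- 0`.
  have h2 : y i (τ + 1) S * W τ S ≤ (if τ ≠ 0 then y i (τ + 1) S else 0) * U (τ + 1) S i := by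
    split_ifs with h
    · exact mul_le_mul_of_nonneg_left (hdiscard τ S i) (hxy.y_nonneg _ _ _)
    · rw [not_not.1 h, hW]; simp
  have h3 : ∑ j ∈ S, x i j (τ + 1) (S.erase j) * (a (τ + 1) i j + W τ (S.erase j))
      ≤ (∑ j ∈ S, x i j (τ + 1) (S.erase j)) * U (τ + 1) S i := by
    rw [sum_mul]
    exact sum_le_sum fun j hj =>
      mul_le_mul_of_nonneg_left (hmatch τ S i j hj) (hxy.x_nonneg _ _ _ _)
  rw [add_mul] at h1
  rw [← mul_assoc, mul_comm (inflow _ _ _ _ _)]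
  linarith

end Duality

/-! ### Randomized policies, reachable states and ties -/

section Policies

variable {N V : Type*} [Fintype N] [Fintype V] [DecidableEq V]

/-- The ads that are left after an action: `none` discards, `some j` matches to `j`. -/
def leftover (S : Finset V) : Option V → Finset V
  | none => S
  | some j => S.erase j

/-- The reward of an action. -/
def reward (c : V → ℝ) : Option V → ℝ
  | none => 0
  | some j => c j

/-- The weight of `α` under the uniform distribution on `A`. -/
noncomputable def weight (A : Finset (Option V)) (α : Option V) : ℝ :=
  if α ∈ A then (#A : ℝ)⁻¹ else 0

/-- The average of `f` over `A`. -/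
noncomputable def average (A : Finset (Option V)) (f : Option V → ℝ) : ℝ := ∑ α, weight A α * f α

theorem weight_nonneg (A : Finset (Option V)) (α : Option V) : 0 ≤ weight A α := by
  unfold weight; split_ifs <;> positivity

theorem weight_pos {A : Finset (Option V)} {α : Option V} (h : α ∈ A) : 0 < weight A α := by
  rw [weight, if_pos h]
  have : 0 < #A := card_pos.2 ⟨α, h⟩
  positivity

theorem sum_weight {A : Finset (Option V)} (hA : A.Nonempty) : ∑ α, weight A α = 1 := by
  have : (#A : ℝ) ≠ 0 := by exact_mod_cast (card_pos.2 hA).ne'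
  simp only [weight]
  rw [← sum_filter, filter_mem_eq_inter, univ_inter, sum_const, nsmul_eq_mul, mul_inv_cancel₀ this]

theorem average_congr {A : Finset (Option V)} (hA : A.Nonempty) {f : Option V → ℝ} {b : ℝ}
    (h : ∀ α ∈ A, f α = b) : average A f = b := by
  rw [average, ← one_mul b, ← sum_weight hA, sum_mul]
  refine sum_congr rfl fun α _ => ?_
  by_cases hα : α ∈ A
  · rw [h α hα]
  · simp [weight, hα]

/-- The distribution of the set of available ads after `m` stages, for the policy that chooses
uniformly among the actions `T τ S i`. -/
noncomputable def dist (n : ℕ) (T : ℕ → Finset V → N → Finset (Option V)) : ℕ → Finset V → ℝ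
  | 0, S => if S = univ then 1 else 0
  | m + 1, S =>
    (if n - (m + 1) < #S then ∑ k, dist n T m S / n * weight (T (n - m) S k) none else 0)
      + ∑ k, ∑ j ∈ univ \ S,
        dist n T m (insert j S) / n * weight (T (n - m) (insert j S) k) (some j)

/-- The matching decisions of the policy choosing uniformly among the actions `T`. -/
noncomputable def matchOf (n : ℕ) (T : ℕ → Finset V → N → Finset (Option V)) (i : N) (j : V)
    (τ : ℕ) (S : Finset V) : ℝ :=
  dist n T (n - τ) (insert j S) / n * weight (T τ (insert j S) i) (some j)

/-- The discarding decisions of the policy choosing uniformly among the actions `T`. -/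
noncomputable def discardOf (n : ℕ) (T : ℕ → Finset V → N → Finset (Option V)) (i : N)
    (τ : ℕ) (S : Finset V) : ℝ :=
  dist n T (n - τ) S / n * weight (T τ S i) none

theorem dist_nonneg (n : ℕ) (T : ℕ → Finset V → N → Finset (Option V)) (m : ℕ) (S : Finset V) :
    0 ≤ dist n T m S := by
  induction m generalizing S with
  | zero => rw [dist]; split_ifs <;> norm_num
  | succ m ih =>
    rw [dist]
    have h : ∀ S' α k, 0 ≤ dist n T m S' / n * weight (T (n - m) S' k) α := fun S' α k =>
      mul_nonneg (div_nonneg (ih S') (Nat.cast_nonneg n)) (weight_nonneg _ _)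
    refine add_nonneg ?_ (sum_nonneg fun k _ => sum_nonneg fun j _ => h _ _ _)
    split_ifs
    · exact sum_nonneg fun k _ => h _ _ _
    · exact le_rfl

/-- `dist` counts elapsed stages upwards, while τ counts remaining stages downwards; hence the index
n - τ. -/
theorem inflow_of {n τ : ℕ} (hτ : τ ≤ n) (T : ℕ → Finset V → N → Finset (Option V))
    (S : Finset V) : inflow n (matchOf n T) (discardOf n T) τ S = dist n T (n - τ) S := by
  rcases hτ.eq_or_lt with rfl | h
  · rw [inflow, if_pos rfl, Nat.sub_self, dist]
  · obtain ⟨m, rfl⟩ : ∃ m, n = τ + 1 + m := ⟨n - (τ + 1), by omega⟩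
    rw [inflow, if_neg h.ne, show τ + 1 + m - τ = m + 1 by omega, dist]
    simp only [matchOf, discardOf]
    rw [show τ + 1 + m - (τ + 1) = m by omega, show τ + 1 + m - (m + 1) = τ by omega,
      show τ + 1 + m - m = τ + 1 by omega]

theorem isPolicy_of {n : ℕ} (hn : 0 < n) (hV : Fintype.card V = n)
    {T : ℕ → Finset V → N → Finset (Option V)} (hT : ∀ τ S i, (T τ S i).Nonempty) :
    IsPolicy n (matchOf n T) (discardOf n T) := by
  have hx : ∀ i j τ S, 0 ≤ matchOf n T i j τ S := fun i j τ S =>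
    mul_nonneg (div_nonneg (dist_nonneg _ _ _ _) (Nat.cast_nonneg n)) (weight_nonneg _ _)
  have hy : ∀ i τ S, 0 ≤ discardOf n T i τ S := fun i τ S =>
    mul_nonneg (div_nonneg (dist_nonneg _ _ _ _) (Nat.cast_nonneg n)) (weight_nonneg _ _)
  have hsum : ∀ i τ S, ∑ j ∈ S, matchOf n T i j τ (S \ {j}) + discardOf n T i τ S
      ≤ 1 / (n : ℝ) * dist n T (n - τ) S := by
    intro i τ S
    have hd : 0 ≤ dist n T (n - τ) S / n := div_nonneg (dist_nonneg _ _ _ _) (Nat.cast_nonneg n)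
    have h1 : ∑ j ∈ S, matchOf n T i j τ (S \ {j})
        = dist n T (n - τ) S / n * ∑ j ∈ S, weight (T τ S i) (some j) := by
      rw [mul_sum]
      refine sum_congr rfl fun j hj => ?_
      rw [matchOf, sdiff_singleton_eq_erase, insert_erase hj]
    have h2 := sum_weight (hT τ S i)
    rw [Fintype.sum_option] at h2
    have h3 : ∑ j ∈ S, weight (T τ S i) (some j) ≤ ∑ j, weight (T τ S i) (some j) :=
      sum_le_univ_sum_of_nonneg fun j => weight_nonneg _ _
    rw [h1, discardOf, ← mul_add, one_div, ← div_eq_inv_mul]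
    exact mul_le_of_le_one_right hd (by linarith)
  have hsum' : ∀ i τ S (p : Prop) [Decidable p], ∑ j ∈ S, matchOf n T i j τ (S \ {j})
      + (if p then discardOf n T i τ S else 0) ≤ 1 / (n : ℝ) * dist n T (n - τ) S := by
    intro i τ S p _
    have := hsum i τ S
    have := hy i τ S
    split_ifs <;> linarith
  refine ⟨hx, hy, fun i => ?_, fun τ hτ i S _ _ hS => ?_, fun τ hτ i => ?_⟩
  · simpa [dist] using hsum i n univ
  · rw [Finset.mem_Icc] at hτ
    have h := hsum' i τ S (τ ≠ 1)
    rw [← inflow_of (show τ ≤ n by omega) T S, inflow, if_neg (show τ ≠ n by omega), mul_add] at h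
    linarith
  · rw [Finset.mem_Icc] at hτ
    have h := hsum' i τ univ (τ ≠ 1)
    rw [← inflow_of (show τ ≤ n by omega) T univ, inflow, if_neg (show τ ≠ n by omega),
      if_pos (show τ < #(univ : Finset V) by rw [card_univ, hV]; omega), show (univ \ univ : Finset V) = ∅ by simp] at h
    simp only [sum_empty, sum_const_zero, add_zero] at h
    linarith

/-- The matching probabilities of the policy choosing uniformly among the actions `T`. -/
noncomputable def pointOf (n : ℕ) (T : ℕ → Finset V → N → Finset (Option V)) : MatchSpace N V n :=
  fun i j t => matchProb (matchOf n T) i j t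

theorem pointOf_mem {n : ℕ} (hn : 0 < n) (hV : Fintype.card V = n)
    {T : ℕ → Finset V → N → Finset (Option V)} (hT : ∀ τ S i, (T τ S i).Nonempty) :
    pointOf n T ∈ Q N V n :=
  ⟨matchOf n T, discardOf n T, isPolicy_of hn hV hT, fun _ _ _ => rfl⟩

/-- The reward of a policy differs from the value of a potential `W` at the start by the expected
sum of the Bellman errors. -/
theorem pairing_pointOf {n : ℕ} (hV : Fintype.card V = n)
    {T : ℕ → Finset V → N → Finset (Option V)} (hTS : ∀ τ S i j, some j ∈ T τ S i → j ∈ S)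
    (c : ℕ → N → V → ℝ) (W : ℕ → Finset V → ℝ) (hW : ∀ S, W 0 S = 0) :
    pairing n c (pointOf n T) = W n univ + ∑ τ ∈ range n, ∑ S : Finset V with τ + 1 ≤ #S,
      dist n T (n - (τ + 1)) S * (1 / (n : ℝ) * ∑ i, average (T (τ + 1) S i)
        (fun α => reward (c (τ + 1) i) α + W τ (leftover S α)) - W (τ + 1) S) := by
  have := pairing_matchProb n (matchOf n T) (discardOf n T) c W hW hV
  refine this.trans ?_
  congr 1
  refine sum_congr rfl fun τ hτ => sum_congr rfl fun S _ => ?_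
  rw [inflow_of (by have := mem_range.1 hτ; omega), mul_sub, mul_sum, mul_sum]
  congr 1
  refine sum_congr rfl fun i _ => ?_
  rw [average, Fintype.sum_option, mul_add, mul_add, mul_sum, mul_sum]
  congr 1
  · simp only [discardOf, reward, leftover]
    ring
  · rw [← sum_subset (subset_univ S)]
    · refine sum_congr rfl fun j hj => ?_
      simp only [matchOf, reward, leftover, insert_erase hj]
      ring
    · intro j _ hj
      rw [weight, if_neg fun h => hj (hTS _ _ _ _ h)]
      simp

/-- Complementary slackness: if only tight actions are used, all Bellman errors vanish. -/
theorem pairing_pointOf_of_tight {n : ℕ} (hV : Fintype.card V = n)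
    {T : ℕ → Finset V → N → Finset (Option V)} (hT : ∀ τ S i, (T τ S i).Nonempty)
    (hTS : ∀ τ S i j, some j ∈ T τ S i → j ∈ S) {a : ℕ → N → V → ℝ} {W : ℕ → Finset V → ℝ}
    {U : ℕ → Finset V → N → ℝ} (hW : ∀ S, W 0 S = 0)
    (htight : ∀ τ S i, ∀ α ∈ T (τ + 1) S i,
      reward (a (τ + 1) i) α + W τ (leftover S α) = U (τ + 1) S i)
    (havg : ∀ τ S, W (τ + 1) S = 1 / (n : ℝ) * ∑ i, U (τ + 1) S i) :
    pairing n a (pointOf n T) = W n univ := by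
  rw [pairing_pointOf hV hTS a W hW, add_eq_left]
  refine sum_eq_zero fun τ _ => sum_eq_zero fun S _ => ?_
  rw [havg, sum_congr rfl fun i _ => average_congr (hT _ _ _) fun α hα => htight τ S i α hα]
  simp

/-- The states reached with positive probability by the policy choosing uniformly among the
actions `T`. -/
inductive Reach (n : ℕ) (T : ℕ → Finset V → N → Finset (Option V)) : ℕ → Finset V → Prop
  | start : Reach n T n univ
  | step (τ : ℕ) (S : Finset V) (i : N) (α : Option V) :
      Reach n T (τ + 1) S → α ∈ T (τ + 1) S i → Reach n T τ (leftover S α)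

theorem Reach.le {n : ℕ} {T : ℕ → Finset V → N → Finset (Option V)} {τ : ℕ} {S : Finset V}
    (h : Reach n T τ S) : τ ≤ n := by
  induction h <;> omega

theorem Reach.le_card {n : ℕ} (hV : Fintype.card V = n)
    {T : ℕ → Finset V → N → Finset (Option V)} {τ : ℕ} {S : Finset V}
    (h : Reach n T τ S) : τ ≤ #S := by
  induction h with
  | start => rw [card_univ, hV]
  | step τ S i α _ _ ih =>
    cases α with
    | none => exact (Nat.le_succ τ).trans ih
    | some j => have := pred_card_le_card_erase (s := S) (a := j); simp only [leftover]; omega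

/-- Only the stages played before τ matter, so the bound survives a change of policy at τ or later
in time. -/
theorem Reach.dist_pos {n : ℕ} (hn : 0 < n) (hV : Fintype.card V = n)
    {T T' : ℕ → Finset V → N → Finset (Option V)}
    (hTS : ∀ τ S i j, some j ∈ T τ S i → j ∈ S) {τ : ℕ} {S : Finset V}
    (h : Reach n T τ S) (hT' : ∀ σ, τ < σ → T' σ = T σ) : 0 < dist n T' (n - τ) S := by
  induction h with
  | start => simp [dist]
  | step τ S i α hr hα ih =>
    have hpos := ih fun σ hσ => hT' σ (by omega)
    have hle := hr.le
    have hcard := hr.le_card hV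
    obtain ⟨m, rfl⟩ : ∃ m, n = τ + 1 + m := ⟨n - (τ + 1), by omega⟩
    rw [show τ + 1 + m - (τ + 1) = m by omega] at hpos
    rw [show τ + 1 + m - τ = m + 1 by omega, dist, show τ + 1 + m - (m + 1) = τ by omega,
      show τ + 1 + m - m = τ + 1 by omega, hT' (τ + 1) (by omega)]
    have hnn : ∀ S' α k, 0 ≤ dist (τ + 1 + m) T' m S' / ((τ + 1 + m : ℕ) : ℝ)
        * weight (T (τ + 1) S' k) α := fun S' α k =>
      mul_nonneg (div_nonneg (dist_nonneg _ _ _ _) (Nat.cast_nonneg _)) (weight_nonneg _ _)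
    have hp : 0 < dist (τ + 1 + m) T' m S / ((τ + 1 + m : ℕ) : ℝ) * weight (T (τ + 1) S i) α :=
      mul_pos (div_pos hpos (by exact_mod_cast hn)) (weight_pos hα)
    cases α with
    | none =>
      refine add_pos_of_pos_of_nonneg ?_ (sum_nonneg fun k _ => sum_nonneg fun j _ => hnn _ _ _)
      rw [leftover, if_pos (by omega)]
      exact sum_pos' (fun k _ => hnn _ _ _) ⟨i, mem_univ _, hp⟩
    | some j =>
      refine add_pos_of_nonneg_of_pos ?_ ?_
      · split_ifs
        · exact sum_nonneg fun k _ => hnn _ _ _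
        · exact le_rfl
      · refine sum_pos' (fun k _ => sum_nonneg fun j _ => hnn _ _ _) ⟨i, mem_univ _, ?_⟩
        refine sum_pos' (fun j _ => hnn _ _ _) ⟨j, by simp [leftover], ?_⟩
        rw [leftover, insert_erase (hTS _ _ _ _ hα)]
        exact hp

/-- The expected reward of the policy choosing uniformly among the actions `T`, from stage `τ`
on. -/
noncomputable def value (n : ℕ) (T : ℕ → Finset V → N → Finset (Option V)) (c : ℕ → N → V → ℝ) :
    ℕ → Finset V → ℝ
  | 0, _ => 0
  | τ + 1, S => 1 / (n : ℝ) * ∑ i, average (T (τ + 1) S i)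
      (fun α => reward (c (τ + 1) i) α + value n T c τ (leftover S α))

/-- If `a` is maximized exactly by the policies using the actions `T`, and `c` is constant on the
face of maximizers of `a`, then at every reachable state all actions in `T` are equally good
for `c`. -/
theorem reward_add_value_eq {n : ℕ} (hn : 0 < n) (hV : Fintype.card V = n)
    {T : ℕ → Finset V → N → Finset (Option V)} (hT : ∀ τ S i, (T τ S i).Nonempty)
    (hTS : ∀ τ S i j, some j ∈ T τ S i → j ∈ S) {a : ℕ → N → V → ℝ} {W : ℕ → Finset V → ℝ}
    {U : ℕ → Finset V → N → ℝ} (hW : ∀ S, W 0 S = 0)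
    (htight : ∀ τ S i, ∀ α ∈ T (τ + 1) S i,
      reward (a (τ + 1) i) α + W τ (leftover S α) = U (τ + 1) S i)
    (havg : ∀ τ S, W (τ + 1) S = 1 / (n : ℝ) * ∑ i, U (τ + 1) S i)
    {c : ℕ → N → V → ℝ}
    (hc : ∀ z ∈ {z ∈ Q N V n | pairing n a z = W n univ},
      ∀ z' ∈ {z ∈ Q N V n | pairing n a z = W n univ}, pairing n c z = pairing n c z')
    {τ : ℕ} {S : Finset V} (hr : Reach n T (τ + 1) S) (i : N) {α β : Option V}
    (hα : α ∈ T (τ + 1) S i) (hβ : β ∈ T (τ + 1) S i) :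
    reward (c (τ + 1) i) α + value n T c τ (leftover S α)
      = reward (c (τ + 1) i) β + value n T c τ (leftover S β) := by
  classical
  have hface : ∀ T' : ℕ → Finset V → N → Finset (Option V), (∀ τ S i, (T' τ S i).Nonempty) →
      (∀ τ S i, T' τ S i ⊆ T τ S i) →
      pointOf n T' ∈ {z ∈ Q N V n | pairing n a z = W n univ} := by
    intro T' hT' hsub
    exact ⟨pointOf_mem hn hV hT', pairing_pointOf_of_tight hV hT'
      (fun τ S i j h => hTS τ S i j (hsub _ _ _ h)) hW
      (fun τ S i α h => htight τ S i α (hsub _ _ _ h)) havg⟩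
  suffices h : ∀ α ∈ T (τ + 1) S i, reward (c (τ + 1) i) α + value n T c τ (leftover S α)
      = average (T (τ + 1) S i)
        (fun α => reward (c (τ + 1) i) α + value n T c τ (leftover S α)) from
    (h α hα).trans (h β hβ).symm
  clear hα hβ α β
  intro α hα
  -- The deviating policy forces α for the impression i in state S of stage τ + 1, and nowhere else.
  set T' : ℕ → Finset V → N → Finset (Option V) := fun σ S' i' =>
    if σ = τ + 1 ∧ S' = S ∧ i' = i then {α} else T σ S' i' with hT'def
  have hsub : ∀ σ S' i', T' σ S' i' ⊆ T σ S' i' := by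
    intro σ S' i'
    simp only [hT'def]
    split_ifs with h
    · obtain ⟨rfl, rfl, rfl⟩ := h
      simpa using hα
    · exact subset_rfl
  have hne : ∀ σ S' i', (T' σ S' i').Nonempty := by
    intro σ S' i'
    simp only [hT'def]
    split_ifs with h
    · exact singleton_nonempty _
    · exact hT _ _ _
  have h1 := hc _ (hface T' hne hsub) _ (hface T hT fun _ _ _ => subset_rfl)
  have h0 : ∀ S, value n T c 0 S = 0 := fun S => rfl
  -- With the value of T as potential, T has no Bellman error and T' has one at most, at (τ + 1, S,
  -- i). Equal rewards and positive probability of S force that error to vanish.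
  rw [pairing_pointOf hV (fun τ S i j h => hTS τ S i j (hsub _ _ _ h)) c (value n T c) h0,
    pairing_pointOf hV hTS c (value n T c) h0, add_right_inj] at h1
  have hle := hr.le
  have hpos : 0 < dist n T' (n - (τ + 1)) S := hr.dist_pos hn hV hTS fun σ hσ => by
    funext S' i'
    simp only [hT'def]
    rw [if_neg (by omega)]
  rw [sum_eq_zero (s := range n) (f := fun σ => ∑ S : Finset V with σ + 1 ≤ #S,
      dist n T (n - (σ + 1)) S * (1 / (n : ℝ) * ∑ i, average (T (σ + 1) S i)
        (fun α => reward (c (σ + 1) i) α + value n T c σ (leftover S α)) - value n T c (σ + 1) S))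
      (fun σ _ => sum_eq_zero fun S' _ => by simp [value])] at h1
  rw [sum_eq_single τ, sum_eq_single S] at h1
  · have h2 := (mul_eq_zero.1 h1).resolve_left hpos.ne'
    rw [value, ← mul_sub, ← sum_sub_distrib] at h2
    have h3 := (mul_eq_zero.1 h2).resolve_left (by positivity)
    rw [sum_eq_single i] at h3
    · have h4 : T' (τ + 1) S i = {α} := by simp [hT'def]
      rw [h4, average_congr (singleton_nonempty α) (fun β hβ => by rw [mem_singleton.1 hβ])] at h3
      exact sub_eq_zero.1 h3
    · intro i' _ hi'
      simp [hT'def, hi']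
    · simp
  · intro S' _ hS'
    simp [hT'def, hS', value]
  · intro h
    exact absurd (hr.le_card hV) (by simpa using h)
  · intro σ _ hσ
    refine sum_eq_zero fun S' _ => ?_
    simp [hT'def, hσ, value]
  · intro h
    rw [mem_range] at h
    omega

end Policies

/-! ### Dimension by dual annihilators -/

section Dimension

/-- A functional is constant on P exactly when it annihilates all differences of points of P. -/
theorem finrank_vectorSpan_add_finrank_dualAnnihilator {E : Type*} [AddCommGroup E] [Module ℝ E]
    [FiniteDimensional ℝ E] (P : Set E) (A : Submodule ℝ (Module.Dual ℝ E))
    (hA : ∀ ψ : Module.Dual ℝ E, ψ ∈ A ↔ ∀ z ∈ P, ∀ z' ∈ P, ψ z = ψ z') :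
    Module.finrank ℝ (vectorSpan ℝ P) + Module.finrank ℝ A = Module.finrank ℝ E := by
  have : A = (vectorSpan ℝ P).dualAnnihilator := by
    ext ψ
    rw [hA, Submodule.mem_dualAnnihilator]
    constructor
    · intro h
      have : vectorSpan ℝ P ≤ LinearMap.ker ψ := by
        rw [vectorSpan, Submodule.span_le]
        rintro _ ⟨z, hz, z', hz', rfl⟩
        simp [h z hz z' hz']
      exact fun w hw => this hw
    · intro h z hz z' hz'
      have := h _ (vsub_mem_vectorSpan ℝ hz hz')
      simpa [sub_eq_zero] using this
  rw [this]
  exact Subspace.finrank_add_finrank_dualAnnihilator_eq _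

/-- A criterion for an inequality to be facet-defining, for a full-dimensional set. -/
theorem isFacetDefining_of_dual {E : Type*} [AddCommGroup E] [Module ℝ E]
    [FiniteDimensional ℝ E] {P : Set E} {φ : E →ₗ[ℝ] ℝ} {b : ℝ} (hφ : φ ≠ 0)
    (hvalid : ∀ z ∈ P, φ z ≤ b) (hne : {z ∈ P | φ z = b}.Nonempty)
    (hP : ∀ ψ : E →ₗ[ℝ] ℝ, (∀ z ∈ P, ∀ z' ∈ P, ψ z = ψ z') → ψ = 0)
    (hF : ∀ ψ : E →ₗ[ℝ] ℝ, (∀ z ∈ {z ∈ P | φ z = b}, ∀ z' ∈ {z ∈ P | φ z = b}, ψ z = ψ z') →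
      ∃ l : ℝ, ψ = l • φ) :
    IsFacetDefining P φ b := by
  refine ⟨hvalid, hne, ?_⟩
  have h1 := finrank_vectorSpan_add_finrank_dualAnnihilator P ⊥ fun ψ => by
    rw [Submodule.mem_bot]
    exact ⟨fun h => by simp [h], hP ψ⟩
  have h2 := finrank_vectorSpan_add_finrank_dualAnnihilator {z ∈ P | φ z = b}
    (Submodule.span ℝ {φ}) fun ψ => by
      rw [Submodule.mem_span_singleton]
      constructor
      · rintro ⟨l, rfl⟩ z hz z' hz'
        simp [hz.2, hz'.2]
      · intro h
        obtain ⟨l, hl⟩ := hF ψ h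
        exact ⟨l, hl.symm⟩
  rw [finrank_span_singleton hφ] at h2
  rw [finrank_bot] at h1
  omega

variable {N V : Type*} [Fintype N] [Fintype V] [DecidableEq V]

theorem pairing_single [DecidableEq N] {n : ℕ} (c : ℕ → N → V → ℝ) (i : N) (j : V)
    (τ : Stage n) : pairing n c (Pi.single i (Pi.single j (Pi.single τ 1))) = c τ i j := by
  rw [pairing_apply, sum_eq_single τ, sum_eq_single i, sum_eq_single j]
  · simp
  · intro j' _ hj'; simp [hj']
  · simp
  · intro i' _ hi'; simp [hi']
  · simp
  · intro τ' _ hτ'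
    refine sum_eq_zero fun i' _ => sum_eq_zero fun j' _ => ?_
    by_cases hi : i' = i
    · subst hi
      by_cases hj : j' = j
      · subst hj; simp [hτ']
      · simp [hj]
    · simp [hi]
  · simp

theorem exists_eq_pairing {n : ℕ} (ψ : MatchSpace N V n →ₗ[ℝ] ℝ) :
    ∃ c : ℕ → N → V → ℝ, ψ = pairing n c := by
  classical
  refine ⟨fun τ i j => if hτ : τ ∈ Finset.Icc 1 n then
    ψ (Pi.single i (Pi.single j (Pi.single ⟨τ, hτ⟩ 1))) else 0, ?_⟩
  refine LinearMap.pi_ext' fun i => LinearMap.pi_ext' fun j => LinearMap.pi_ext' fun τ => ?_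
  ext
  simp only [LinearMap.comp_apply, LinearMap.single_apply]
  rw [pairing_single, dif_pos τ.2]

theorem pairing_congr {n : ℕ} {c d : ℕ → N → V → ℝ}
    (h : ∀ τ ∈ Finset.Icc 1 n, ∀ i j, c τ i j = d τ i j) :
    (pairing n c : MatchSpace N V n →ₗ[ℝ] ℝ) = pairing n d := by
  ext z
  rw [pairing_apply, pairing_apply]
  exact sum_congr rfl fun τ _ => sum_congr rfl fun i _ => sum_congr rfl fun j _ => by
    rw [h τ τ.2]

theorem value_eq_zero {n : ℕ} {T : ℕ → Finset V → N → Finset (Option V)} {c : ℕ → N → V → ℝ}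
    (τ : ℕ) (hc : ∀ σ < τ, ∀ i j, c (σ + 1) i j = 0) (S : Finset V) : value n T c τ S = 0 := by
  induction τ generalizing S with
  | zero => rfl
  | succ τ ih =>
    rw [value, sum_eq_zero, mul_zero]
    intro i _
    rw [average]
    refine sum_eq_zero fun α _ => ?_
    rw [ih fun σ hσ => hc σ (by omega)]
    cases α with
    | none => simp [reward]
    | some j => simp [reward, hc τ (by omega)]

theorem Reach.discard {n : ℕ} {T : ℕ → Finset V → N → Finset (Option V)} {σ τ : ℕ}
    {S : Finset V} (h : Reach n T σ S) (hτ : τ ≤ σ)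
    (hT : ∀ ρ, τ ≤ ρ → ρ < σ → ∃ i, none ∈ T (ρ + 1) S i) : Reach n T τ S := by
  obtain ⟨k, rfl⟩ : ∃ k, σ = τ + k := ⟨σ - τ, by omega⟩
  induction k with
  | zero => exact h
  | succ k ih =>
    obtain ⟨i, hi⟩ := hT (τ + k) (by omega) (by omega)
    exact ih (Reach.step _ _ i none h hi) (by omega) fun ρ h1 h2 => hT ρ h1 (by omega)

/-- The polyhedron `Q` is full-dimensional. -/
theorem eq_zero_of_const_on_Q {n : ℕ} (hn : 0 < n) (hN : Fintype.card N = n)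
    (hV : Fintype.card V = n) (ψ : MatchSpace N V n →ₗ[ℝ] ℝ)
    (hψ : ∀ z ∈ Q N V n, ∀ z' ∈ Q N V n, ψ z = ψ z') : ψ = 0 := by
  obtain ⟨c, rfl⟩ := exists_eq_pairing ψ
  obtain ⟨i₀⟩ : Nonempty N := Fintype.card_pos_iff.1 (by omega)
  set T : ℕ → Finset V → N → Finset (Option V) := fun _ S _ => insertNone S with hT
  have key : ∀ τ < n, ∀ i j, c (τ + 1) i j = 0 := by
    intro τ
    induction τ using Nat.strong_induction_on with
    | _ τ ih =>
    intro hτ i j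
    have hr : Reach n T (τ + 1) univ := Reach.start.discard hτ fun ρ _ _ => ⟨i₀, by simp [hT]⟩
    -- For the zero objective with zero potentials every action is tight, and the face is all of Q.
    have h := reward_add_value_eq hn hV (T := T) (a := fun _ _ _ => 0) (W := fun _ _ => 0)
      (U := fun _ _ _ => 0) (c := c) (fun τ S i => ⟨none, by simp [hT]⟩)
      (fun τ S i j h => by simpa [hT] using h) (fun _ => rfl)
      (fun τ S i α _ => by cases α <;> simp [reward]) (fun τ S => by simp)
      (fun z hz z' hz' => hψ z hz.1 z' hz'.1) hr i (α := some j) (β := none)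
      (by simp [hT]) (by simp [hT])
    have h0 := value_eq_zero (n := n) (T := T) τ fun σ hσ => ih σ hσ (by omega)
    rw [h0, h0] at h
    simpa [reward] using h
  rw [pairing_congr (d := fun _ _ _ => 0)]
  · ext z; simp [pairing_apply]
  · intro τ hτ i j
    rw [Finset.mem_Icc] at hτ
    obtain ⟨k, rfl⟩ : ∃ k, τ = k + 1 := ⟨τ - 1, by omega⟩
    exact key k (by omega) i j

end Dimension

/-! ### The Bellman solution for the facet inequality -/

section Facet

/-- The parameters of the inequality: `M τ` is the set of impressions whose matches to `J` count
in stage `τ`, for `t ≤ τ < t + h`. -/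
structure IsFacetData {N V : Type*} [Fintype N] [Fintype V] (n h r t : ℕ)
    (J : Finset V) (M : ℕ → Finset N) : Prop where
  card_N : Fintype.card N = n
  card_V : Fintype.card V = n
  one_le_h : 1 ≤ h
  one_le_r : 1 ≤ r
  r_lt : r < n
  one_le_t : 1 ≤ t
  add_le : t + h ≤ n
  two_le_or : 2 ≤ h ∨ r = 1
  card_J : #J = h
  card_M : ∀ τ, t ≤ τ → τ + 1 < t + h → #(M τ) = 1
  card_M_last : #(M (t + h - 1)) = r

/-- The marginal value of the `m`-th remaining ad of `J`, if there are enough stages left. -/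
def marginal (n h r m : ℕ) : ℝ := if m < h then (n : ℝ) ^ (h - m) else r

/-- The sum of the first `m` marginal values. -/
def total (n h r m : ℕ) : ℝ := ∑ l ∈ range m, marginal n h r (l + 1)

variable {N V : Type*} [Fintype N] [Fintype V] [DecidableEq V] [DecidableEq N]

/-- The coefficients of the inequality. -/
def coeff (n h r t : ℕ) (J : Finset V) (M : ℕ → Finset N) (τ : ℕ) (i : N) (j : V) : ℝ :=
  if j ∈ J then
    if t + h ≤ τ then (r : ℝ) else if t ≤ τ ∧ i ∈ M τ then (n : ℝ) ^ (t + h - τ) else 0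
  else 0

/-- The maximal reward from stage `τ` on, when the set `S` of ads is available. -/
def optValue (n h r t : ℕ) (J : Finset V) (τ : ℕ) (S : Finset V) : ℝ :=
  total n h r (min (τ + 1 - t) #(S ∩ J))

/-- The maximal reward from stage `τ` on, when the set `S` of ads is available and the
impression `i` appears. -/
def optReward (n h r t : ℕ) (J : Finset V) (M : ℕ → Finset N) (τ : ℕ) (S : Finset V) (i : N) : ℝ :=
  if t ≤ τ ∧ τ + 1 - t ≤ #(S ∩ J) ∧ i ∈ M τ then
    (n : ℝ) ^ (t + h - τ) + total n h r (τ - t) else total n h r (min (τ - t) #(S ∩ J))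

/-- The optimal actions. -/
noncomputable def optActions (n h r t : ℕ) (J : Finset V) (M : ℕ → Finset N) (τ : ℕ)
    (S : Finset V) (i : N) : Finset (Option V) :=
  {α ∈ insertNone S | reward (coeff n h r t J M τ i) α
    + optValue n h r t J (τ - 1) (leftover S α) = optReward n h r t J M τ S i}

theorem marginal_nonneg (n h r m : ℕ) : 0 ≤ marginal n h r m := by
  unfold marginal; split_ifs <;> positivity

theorem total_nonneg (n h r m : ℕ) : 0 ≤ total n h r m :=
  sum_nonneg fun _ _ => marginal_nonneg _ _ _ _

theorem total_succ (n h r m : ℕ) :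
    total n h r (m + 1) = total n h r m + marginal n h r (m + 1) := sum_range_succ _ _

theorem total_zero (n h r : ℕ) : total n h r 0 = 0 := by simp [total]

theorem card_erase_inter_of_notMem {S J : Finset V} {j : V} (hj : j ∉ J) :
    #(S.erase j ∩ J) = #(S ∩ J) := by
  rw [erase_inter, erase_eq_of_notMem]
  simp [hj]

theorem card_erase_inter_of_mem {S J : Finset V} {j : V} (hS : j ∈ S) (hj : j ∈ J) :
    #(S.erase j ∩ J) + 1 = #(S ∩ J) := by
  rw [erase_inter, card_erase_add_one]
  simp [hj, hS]

variable {n h r t : ℕ} {J : Finset V} {M : ℕ → Finset N}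

theorem some_mem_optActions {τ : ℕ} {S : Finset V} {i : N} {j : V} :
    some j ∈ optActions n h r t J M (τ + 1) S i ↔ j ∈ S ∧ coeff n h r t J M (τ + 1) i j
      + optValue n h r t J τ (S.erase j) = optReward n h r t J M (τ + 1) S i := by
  simp [optActions, reward, leftover]

theorem none_mem_optActions {τ : ℕ} {S : Finset V} {i : N} :
    none ∈ optActions n h r t J M (τ + 1) S i ↔
      optValue n h r t J τ S = optReward n h r t J M (τ + 1) S i := by
  simp [optActions, reward, leftover]

theorem none_mem_of_not {τ : ℕ} {S : Finset V} {i : N}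
    (hc : ¬ (t ≤ τ + 1 ∧ τ + 1 + 1 - t ≤ #(S ∩ J) ∧ i ∈ M (τ + 1))) :
    none ∈ optActions n h r t J M (τ + 1) S i := by
  rw [none_mem_optActions, optValue, optReward, if_neg hc]

theorem some_mem_of_notMem {τ : ℕ} {S : Finset V} {i : N} {j : V} (hj : j ∉ J) (hS : j ∈ S)
    (hc : ¬ (t ≤ τ + 1 ∧ τ + 1 + 1 - t ≤ #(S ∩ J) ∧ i ∈ M (τ + 1))) :
    some j ∈ optActions n h r t J M (τ + 1) S i := by
  rw [some_mem_optActions]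
  refine ⟨hS, ?_⟩
  rw [optValue, optReward, if_neg hc, card_erase_inter_of_notMem hj, coeff, if_neg hj, zero_add]

theorem some_mem_of_lt {τ : ℕ} {S : Finset V} {i : N} {j : V} (hS : j ∈ S) (hτ : τ + 1 < t) :
    some j ∈ optActions n h r t J M (τ + 1) S i := by
  rw [some_mem_optActions]
  refine ⟨hS, ?_⟩
  rw [optValue, optReward, if_neg (by omega), coeff, if_neg (show ¬ t + h ≤ τ + 1 by omega),
    if_neg (show ¬ (t ≤ τ + 1 ∧ i ∈ M (τ + 1)) by omega), show τ + 1 - t = 0 by omega]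
  simp [total_zero]

namespace IsFacetData

variable (H : IsFacetData n h r t J M)

include H

theorem n_pos : 0 < n := by have := H.r_lt; omega

theorem card_inter_le (S : Finset V) : #(S ∩ J) ≤ h := H.card_J ▸ card_le_card inter_subset_right

theorem M_nonempty {τ : ℕ} (h1 : t ≤ τ) (h2 : τ < t + h) : (M τ).Nonempty := by
  rw [← card_pos]
  by_cases h3 : τ + 1 < t + h
  · rw [H.card_M τ h1 h3]; norm_num
  · rw [show τ = t + h - 1 by omega, H.card_M_last]; exact H.one_le_r

theorem exists_notMem {τ : ℕ} (h1 : t ≤ τ) (h2 : τ < t + h) : ∃ i, i ∉ M τ := by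
  have hlt : #(M τ) < Fintype.card N := by
    rw [H.card_N]
    by_cases h3 : τ + 1 < t + h
    · rw [H.card_M τ h1 h3]; have := H.r_lt; have := H.one_le_r; omega
    · rw [show τ = t + h - 1 by omega, H.card_M_last]; exact H.r_lt
  by_contra! hcon
  rw [eq_univ_of_forall hcon, card_univ] at hlt
  exact hlt.false

/-- This is where the assumption h ≥ 2 or r = 1 enters: for h = 1 the first set `M t` is also the
last one, of size r. -/
theorem card_M_first : #(M t) = 1 := by
  rcases H.two_le_or with h2 | h2
  · exact H.card_M t le_rfl (by omega)
  · by_cases h3 : t + 1 < t + h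
    · exact H.card_M t le_rfl h3
    · have := H.card_M_last
      have h1 := H.one_le_h
      rwa [show t + h - 1 = t by omega, h2] at this

/-- Concavity of the value in the number of ads; the step from n to r uses r < n. -/
theorem marginal_le {m k : ℕ} (hmk : m ≤ k) (_ : k ≤ h) : marginal n h r k ≤ marginal n h r m := by
  have hn : (1 : ℝ) ≤ n := by exact_mod_cast H.n_pos
  unfold marginal
  split_ifs with h1 h2 h2
  · exact pow_le_pow_right₀ hn (by omega)
  · omega
  · calc (r : ℝ) ≤ n := by exact_mod_cast H.r_lt.le
      _ = (n : ℝ) ^ 1 := (pow_one _).symm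
      _ ≤ _ := pow_le_pow_right₀ hn (by omega)
  · exact le_rfl

theorem card_M_mul {m : ℕ} (hm : m < h) :
    1 / (n : ℝ) * (#(M (t + m)) * (n : ℝ) ^ (h - m)) = marginal n h r (m + 1) := by
  have hn : (n : ℝ) ≠ 0 := by exact_mod_cast H.n_pos.ne'
  unfold marginal
  split_ifs with h1
  · rw [H.card_M _ (by omega) (by omega), show h - m = h - (m + 1) + 1 by omega, pow_succ]
    field_simp
    simp
  · have := H.card_M_last
    rw [show t + h - 1 = t + m by omega] at this
    rw [this, show h - m = 1 by omega]
    field_simp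

theorem coeff_high {τ : ℕ} (hτ : t + h ≤ τ) (i : N) {j : V} (hj : j ∈ J) :
    coeff n h r t J M τ i j = marginal n h r h := by
  simp [coeff, hj, hτ, marginal]

theorem optValue_le (τ : ℕ) (S : Finset V) (i : N) :
    optValue n h r t J τ S ≤ optReward n h r t J M (τ + 1) S i := by
  rw [optValue, optReward]
  split_ifs with hc
  · rw [min_eq_left (by omega)]
    have : (0 : ℝ) ≤ (n : ℝ) ^ (t + h - (τ + 1)) := by positivity
    linarith
  · exact le_rfl

/-- Using up an ad of J costs nothing if enough ads remain for the rewarded stages to come.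
Otherwise it costs the marginal value of the last ad, which by concavity is at least the pay: the
pay is r, the smallest marginal, in stages from t + h on, and the m-th marginal in stage t + m. -/
theorem coeff_add_optValue_le (τ : ℕ) (S : Finset V) (i : N) {j : V} (hS : j ∈ S) :
    coeff n h r t J M (τ + 1) i j + optValue n h r t J τ (S.erase j)
      ≤ optReward n h r t J M (τ + 1) S i := by
  by_cases hj : j ∈ J
  · have hk := H.card_inter_le S
    have he := card_erase_inter_of_mem hS hj
    obtain ⟨k, hk'⟩ : ∃ k, #(S.erase j ∩ J) = k := ⟨_, rfl⟩
    rw [hk'] at he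
    rw [← he] at hk
    rw [optValue, optReward, hk', ← he]
    by_cases h1 : t + h ≤ τ + 1
    · rw [H.coeff_high h1 i hj, if_neg (by omega), min_eq_right (by omega),
        min_eq_right (by omega), total_succ]
      have := H.marginal_le hk le_rfl
      linarith
    · rw [coeff, if_pos hj, if_neg h1]
      by_cases h2 : t ≤ τ + 1 ∧ i ∈ M (τ + 1)
      · rw [if_pos h2]
        by_cases h3 : τ + 1 + 1 - t ≤ k + 1
        · rw [if_pos ⟨h2.1, h3, h2.2⟩, min_eq_left (by omega)]
        · rw [if_neg (by omega), min_eq_right (by omega), min_eq_right (by omega), total_succ]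
          have := H.marginal_le (m := k + 1) (k := τ + 1 - t) (by omega) (by omega)
          rw [marginal, if_pos (by omega), show h - (τ + 1 - t) = t + h - (τ + 1) by omega] at this
          linarith
      · rw [if_neg h2, if_neg (by tauto), zero_add]
        exact sum_le_sum_of_subset_of_nonneg (range_subset_range.2 (by omega))
          fun _ _ _ => marginal_nonneg _ _ _ _
  · rw [coeff, if_neg hj, zero_add, optValue, card_erase_inter_of_notMem hj]
    exact H.optValue_le τ S i

theorem optValue_eq_average (τ : ℕ) (S : Finset V) :
    optValue n h r t J (τ + 1) S = 1 / (n : ℝ) * ∑ i, optReward n h r t J M (τ + 1) S i := by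
  have hn : (n : ℝ) ≠ 0 := by exact_mod_cast H.n_pos.ne'
  have hk := H.card_inter_le S
  simp only [optValue, optReward]
  by_cases h1 : t ≤ τ + 1 ∧ τ + 1 + 1 - t ≤ #(S ∩ J)
  · obtain ⟨m, hm⟩ : ∃ m, τ + 1 = t + m := ⟨τ + 1 - t, by omega⟩
    have hsum : ∀ i, (if t ≤ τ + 1 ∧ τ + 1 + 1 - t ≤ #(S ∩ J) ∧ i ∈ M (τ + 1) then
        (n : ℝ) ^ (t + h - (τ + 1)) + total n h r (τ + 1 - t) else
        total n h r (min (τ + 1 - t) #(S ∩ J)))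
        = total n h r m + if i ∈ M (t + m) then (n : ℝ) ^ (h - m) else 0 := by
      intro i
      rw [min_eq_left (by omega), hm, show t + h - (t + m) = h - m by omega,
        show t + m - t = m by omega]
      by_cases h2 : i ∈ M (t + m)
      · rw [if_pos ⟨by omega, by omega, h2⟩, if_pos h2, add_comm]
      · rw [if_neg (by tauto), if_neg h2, add_zero]
    rw [sum_congr rfl fun i _ => hsum i, sum_add_distrib, ← sum_filter, filter_mem_eq_inter,
      univ_inter, sum_const, sum_const, card_univ, H.card_N, nsmul_eq_mul, nsmul_eq_mul, mul_add,
      H.card_M_mul (by omega), min_eq_left (by omega), show τ + 1 + 1 - t = m + 1 by omega,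
      total_succ]
    field_simp
  -- Either the stage is below t or the ads of J are the bottleneck; in both cases the extra stage
  -- adds nothing.
  · have hmin : min (τ + 1 + 1 - t) #(S ∩ J) = min (τ + 1 - t) #(S ∩ J) := by omega
    rw [sum_congr rfl fun i _ => if_neg fun h2 => h1 ⟨h2.1, h2.2.1⟩, sum_const, card_univ,
      H.card_N, nsmul_eq_mul, hmin]
    field_simp

theorem optValue_zero (S : Finset V) : optValue n h r t J 0 S = 0 := by
  have := H.one_le_t
  rw [optValue, show min (0 + 1 - t) #(S ∩ J) = 0 by omega, total_zero]

theorem optReward_nonneg (τ : ℕ) (S : Finset V) (i : N) : 0 ≤ optReward n h r t J M τ S i := by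
  have := total_nonneg n h r
  unfold optReward
  split_ifs
  · have := this (τ - t)
    positivity
  · exact this _

theorem pairing_le {z : MatchSpace N V n} (hz : z ∈ Q N V n) :
    pairing n (coeff n h r t J M) z ≤ optValue n h r t J n univ :=
  pairing_le_of_bellman H.card_V H.optValue_zero H.optReward_nonneg
    (fun τ S i _ hj => H.coeff_add_optValue_le τ S i hj) H.optValue_le H.optValue_eq_average hz

/-- In stage t + m the bound on the number k of ads of J is k ≥ m. For k = m the pay n^(h-m) equals
the m-th marginal lost, so that matching ties with discarding. -/
theorem some_mem_of_mem {τ : ℕ} {S : Finset V} {i : N} {j : V} (h1 : t ≤ τ + 1)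
    (h2 : τ + 1 < t + h) (hi : i ∈ M (τ + 1)) (hS : j ∈ S) (hj : j ∈ J)
    (hk : τ + 1 - t ≤ #(S ∩ J)) : some j ∈ optActions n h r t J M (τ + 1) S i := by
  rw [some_mem_optActions]
  refine ⟨hS, ?_⟩
  have he := card_erase_inter_of_mem hS hj
  rw [coeff, if_pos hj, if_neg (by omega), if_pos ⟨h1, hi⟩, optValue, optReward]
  split_ifs with hc
  · rw [min_eq_left (by omega)]
  · have hc' : ¬ τ + 1 + 1 - t ≤ #(S ∩ J) := fun h' => hc ⟨h1, h', hi⟩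
    have hk' : #(S.erase j ∩ J) + 1 = τ + 1 - t := by omega
    rw [min_eq_right (by omega), min_eq_right (by omega), ← he, total_succ, hk', marginal,
      if_pos (by omega), show h - (τ + 1 - t) = t + h - (τ + 1) by omega, add_comm]

/-- An ad of J beyond those needed for the remaining rewarded stages can be wasted at no cost. -/
theorem some_mem_of_notMem_M {τ : ℕ} {S : Finset V} {i : N} {j : V}
    (h2 : τ + 1 < t + h) (hi : i ∉ M (τ + 1)) (hS : j ∈ S) (hj : j ∈ J)
    (hk : τ + 1 - t + 1 ≤ #(S ∩ J)) : some j ∈ optActions n h r t J M (τ + 1) S i := by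
  rw [some_mem_optActions]
  refine ⟨hS, ?_⟩
  have he := card_erase_inter_of_mem hS hj
  rw [coeff, if_pos hj, if_neg (by omega), if_neg (by tauto), optValue, optReward,
    if_neg (by tauto), min_eq_left (by omega), min_eq_left (by omega), zero_add]

theorem some_mem_of_le {τ : ℕ} {S : Finset V} {i : N} {j : V} (hτ : t + h ≤ τ + 1) (hS : j ∈ S)
    (hj : j ∈ J) (hk : #(S ∩ J) = h) : some j ∈ optActions n h r t J M (τ + 1) S i := by
  rw [some_mem_optActions]
  refine ⟨hS, ?_⟩
  have he := card_erase_inter_of_mem hS hj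
  rw [H.coeff_high hτ i hj, optValue, optReward, if_neg (by omega), min_eq_right (by omega),
    min_eq_right (by omega), ← he, total_succ, he, hk, add_comm]

theorem optActions_nonempty (τ : ℕ) (S : Finset V) (i : N) :
    (optActions n h r t J M τ S i).Nonempty := by
  -- Stage 0 is not played, but a policy must have an action at every index.
  rcases τ with _ | τ
  · have := H.one_le_t
    refine ⟨none, ?_⟩
    simp [optActions, reward, leftover, H.optValue_zero, optReward, total_zero, this]
    omega
  by_cases hc : t ≤ τ + 1 ∧ τ + 1 + 1 - t ≤ #(S ∩ J) ∧ i ∈ M (τ + 1)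
  · have hk := H.card_inter_le S
    obtain ⟨j, hj⟩ := card_pos.1 (show 0 < #(S ∩ J) by omega)
    rw [mem_inter] at hj
    exact ⟨some j, H.some_mem_of_mem hc.1 (by omega) hc.2.2 hj.1 hj.2 (by omega)⟩
  · exact ⟨none, none_mem_of_not hc⟩

end IsFacetData

end Facet

/-! ### Reachable states on the face and the ties they give -/

section Facet

variable {N V : Type*} [Fintype N] [Fintype V] [DecidableEq V] [DecidableEq N]
  {n h r t : ℕ} {J : Finset V} {M : ℕ → Finset N}

theorem compl_union_inter {J K : Finset V} (hK : K ⊆ J) : (Jᶜ ∪ K) ∩ J = K := by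
  rw [union_inter_distrib_right, inter_eq_left.2 hK, show Jᶜ ∩ J = ∅ by ext; simp, empty_union]

theorem compl_union_erase {J K : Finset V} {j : V} (hj : j ∈ J) :
    (Jᶜ ∪ K).erase j = Jᶜ ∪ K.erase j := by
  rw [erase_union_distrib, erase_eq_of_notMem (by simpa using hj)]

namespace IsFacetData

variable (H : IsFacetData n h r t J M)

include H

theorem mem_of_some_mem (τ : ℕ) (S : Finset V) (i : N) (j : V)
    (hj : some j ∈ optActions n h r t J M τ S i) : j ∈ S := by
  simpa using (mem_filter.1 hj).1

theorem nonempty_N : Nonempty N := Fintype.card_pos_iff.1 (by rw [H.card_N]; exact H.n_pos)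

theorem card_univ_inter : #(univ ∩ J) = h := by rw [univ_inter, H.card_J]

theorem reach_univ {τ : ℕ} (h1 : t + h ≤ τ + 1) (h2 : τ ≤ n) :
    Reach n (optActions n h r t J M) τ univ := by
  obtain ⟨i₀⟩ := H.nonempty_N
  refine Reach.start.discard h2 fun ρ h3 h4 => ⟨i₀, none_mem_of_not ?_⟩
  rw [H.card_univ_inter]
  omega

theorem reach_erase {j : V} (hj : j ∈ J) :
    Reach n (optActions n h r t J M) (t + h - 1) (univ.erase j) := by
  obtain ⟨i₀⟩ := H.nonempty_N
  have h1 := H.one_le_h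
  refine Reach.step (t + h - 1) univ i₀ (some j) (H.reach_univ (by omega) ?_)
    (H.some_mem_of_le (by omega) (mem_univ j) hj H.card_univ_inter)
  have := H.add_le
  omega

/-- In the first stage of the middle range to be played, t + h - 1, either J is intact or one ad of
J is gone. From then on each stage may use one ad of J, chosen freely, for an impression of `M`. The
number of ads of J thus stays equal to s or s - 1. -/
theorem reach_compl_union {s : ℕ} (hs1 : 1 ≤ s) (hsh : s ≤ h) {K : Finset V} (hK : K ⊆ J)
    (h1 : s ≤ #K + 1) (h2 : #K ≤ s) :
    Reach n (optActions n h r t J M) (t + s - 1) (Jᶜ ∪ K) := by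
  obtain ⟨d, rfl⟩ : ∃ d, h = s + d := ⟨h - s, by omega⟩
  induction d generalizing s K with
  | zero =>
    rw [add_zero] at *
    rcases h2.eq_or_lt with h3 | h3
    · have : K = J := eq_of_subset_of_card_le hK (by rw [H.card_J, h3])
      rw [this, show Jᶜ ∪ J = univ by ext; simp [em']]
      have := H.add_le
      exact H.reach_univ (by omega) (by omega)
    · have hlt : #K < #J := by rw [H.card_J]; exact h3
      obtain ⟨j, hjJ, hjK⟩ := exists_mem_notMem_of_card_lt_card hlt
      have : K = J.erase j := eq_of_subset_of_card_le
        (subset_erase.2 ⟨hK, hjK⟩) (by rw [card_erase_of_mem hjJ, H.card_J]; omega)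
      rw [this, ← compl_union_erase hjJ, show Jᶜ ∪ J = univ by ext; simp [em']]
      exact H.reach_erase hjJ
  | succ d ih =>
    have hlt : #K < #J := by rw [H.card_J]; omega
    obtain ⟨j, hjJ, hjK⟩ := exists_mem_notMem_of_card_lt_card hlt
    have hK' : insert j K ⊆ J := insert_subset hjJ hK
    have hc := card_insert_of_notMem hjK
    have hr := ih (s := s + 1) (K := insert j K) (by omega) hK' (by omega) (by omega)
      (by rwa [show s + 1 + d = s + (d + 1) by omega]) (by omega)
    rw [show s + 1 + d = s + (d + 1) by omega] at hr
    obtain ⟨m, hm⟩ : ∃ m, t + s - 1 = m := ⟨_, rfl⟩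
    rw [show t + (s + 1) - 1 = m + 1 by omega] at hr
    rw [hm]
    obtain ⟨i, hi⟩ := H.M_nonempty (τ := m + 1) (by omega) (by omega)
    have := Reach.step m _ i (some j) hr (H.some_mem_of_mem (by omega) (by omega) hi
      (by simp) hjJ (by rw [compl_union_inter hK']; omega))
    rwa [leftover, compl_union_erase hjJ, erase_insert hjK] at this

/-- An impression outside `M (t + 1)` is discarded, leaving two ads of J for the single rewarded
stage t. -/
theorem reach_pair (hh : 2 ≤ h) {K : Finset V} (hK : K ⊆ J) (h2 : #K = 2) :
    Reach n (optActions n h r t J M) t (Jᶜ ∪ K) := by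
  have hr := H.reach_compl_union (s := 2) (by omega) hh hK (by omega) (by omega)
  rw [show t + 2 - 1 = t + 1 by omega] at hr
  obtain ⟨i, hi⟩ := H.exists_notMem (τ := t + 1) (by omega) (by omega)
  exact Reach.step t _ i none hr (none_mem_of_not (by tauto))

theorem reach_singleton {j : V} (hj : j ∈ J) {τ : ℕ} (hτ : τ < t) :
    Reach n (optActions n h r t J M) τ (Jᶜ ∪ {j}) := by
  obtain ⟨i₀⟩ := H.nonempty_N
  have h1 := H.one_le_h
  have hr := H.reach_compl_union (s := 1) le_rfl h1 (singleton_subset_iff.2 hj) (by simp)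
    (by simp)
  refine hr.discard (by omega) fun ρ h3 h4 => ?_
  by_cases h5 : ρ + 1 = t
  · obtain ⟨i, hi⟩ := H.exists_notMem (τ := ρ + 1) (by omega) (by omega)
    exact ⟨i, none_mem_of_not (by tauto)⟩
  · exact ⟨i₀, none_mem_of_not (by omega)⟩

/-- Induction from the last stage upwards: with c zero in the stages still to come, continuation
values vanish and a tie compares the coefficients of c alone. Each case exhibits a reachable state
with a suitable tie. -/
theorem coeff_eq_zero {c : ℕ → N → V → ℝ}
    (hc : ∀ z ∈ {z ∈ Q N V n | pairing n (coeff n h r t J M) z = optValue n h r t J n univ},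
      ∀ z' ∈ {z ∈ Q N V n | pairing n (coeff n h r t J M) z = optValue n h r t J n univ},
        pairing n c z = pairing n c z')
    {i₁ : N} (hi₁ : i₁ ∈ M t) {j₀ : V} (hj₀ : j₀ ∈ J) (h0 : c t i₁ j₀ = 0) (τ : ℕ) (hτ : τ < n)
    (i : N) (j : V) : c (τ + 1) i j = 0 := by
  induction τ using Nat.strong_induction_on generalizing i j with
  | _ τ ih =>
  have hv : ∀ S, value n (optActions n h r t J M) c τ S = 0 :=
    value_eq_zero τ fun σ hσ i j => ih σ hσ (by omega) i j
  have tie : ∀ {S : Finset V} {α β : Option V}, Reach n (optActions n h r t J M) (τ + 1) S →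
      α ∈ optActions n h r t J M (τ + 1) S i → β ∈ optActions n h r t J M (τ + 1) S i →
      reward (c (τ + 1) i) α = reward (c (τ + 1) i) β := by
    intro S α β hr hα hβ
    have := reward_add_value_eq H.n_pos H.card_V H.optActions_nonempty
      H.mem_of_some_mem H.optValue_zero (fun τ S i α hα => (mem_filter.1 hα).2) H.optValue_eq_average hc hr i hα hβ
    simpa [hv] using this
  have h1 := H.one_le_h
  have hcJ := H.card_J
  by_cases hmid : t ≤ τ + 1 ∧ τ + 1 < t + h
  · obtain ⟨m, hm⟩ : ∃ m, τ + 1 = t + m := ⟨τ + 1 - t, by omega⟩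
    by_cases hj : j ∈ J
    · by_cases hi : i ∈ M (τ + 1)
      · rcases Nat.eq_zero_or_pos m with hm0 | hm0
        · have ht : τ + 1 = t := by omega
          obtain rfl : i = i₁ := by
            have := card_le_one.1 H.card_M_first.le
            exact this i (ht ▸ hi) i₁ hi₁
          by_cases hjj : j = j₀
          · rw [hjj, ht]; exact h0
          -- In stage t discarding is strictly worse for i₁ when an ad of J is left, so j is tied
          -- with j₀ instead.
          · have hc2 : #({j, j₀} : Finset V) = 2 := card_pair hjj
            have hK : ({j, j₀} : Finset V) ⊆ J := insert_subset hj (singleton_subset_iff.2 hj₀)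
            have hh : 2 ≤ h := by rw [← hcJ, ← hc2]; exact card_le_card hK
            have hr := H.reach_pair hh hK hc2
            rw [show Reach n (optActions n h r t J M) t = Reach n (optActions n h r t J M) (τ + 1) by
            rw [ht]] at hr
            have hk : τ + 1 - t ≤ #((Jᶜ ∪ {j, j₀}) ∩ J) := by omega
            have := tie hr (H.some_mem_of_mem hmid.1 hmid.2 hi (by simp) hj hk)
              (H.some_mem_of_mem hmid.1 hmid.2 hi (by simp) hj₀ hk)
            simp only [reward] at this
            rw [this, ht, h0]
        -- Exactly m ads of J: the borderline case, where an impression of `M` may be matched or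
        -- discarded.
        · obtain ⟨K, hjK, hKJ, hKc⟩ := exists_subsuperset_card_eq
            (singleton_subset_iff.2 hj) (n := m) (by rw [card_singleton]; exact hm0) (by omega)
          have hr := H.reach_compl_union (s := m + 1) (by omega) (by omega) hKJ (by omega)
            (by omega)
          rw [show t + (m + 1) - 1 = τ + 1 by omega] at hr
          have hi' := compl_union_inter hKJ
          exact tie hr (H.some_mem_of_mem hmid.1 hmid.2 hi
            (mem_union_right _ (singleton_subset_iff.1 hjK)) hj (by rw [hi']; omega))
            (none_mem_of_not (by rw [hi']; omega))
      -- One ad of J more than the m rewarded stages still to come, so j can be wasted on i.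
      · obtain ⟨K, hjK, hKJ, hKc⟩ := exists_subsuperset_card_eq
          (singleton_subset_iff.2 hj) (n := m + 1) (by simp) (by omega)
        have hr := H.reach_compl_union (s := m + 1) (by omega) (by omega) hKJ (by omega)
          (by omega)
        rw [show t + (m + 1) - 1 = τ + 1 by omega] at hr
        exact tie hr (H.some_mem_of_notMem_M hmid.2 hi
          (mem_union_right _ (singleton_subset_iff.1 hjK)) hj
          (by rw [compl_union_inter hKJ]; omega))
          (none_mem_of_not (by tauto))
    -- With only m ads of J no impression has to be matched into J, so an ad outside J may be used
    -- or not.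
    · obtain ⟨K, hKJ, hKc⟩ := exists_subset_card_eq (s := J) (n := m) (by omega)
      have hr := H.reach_compl_union (s := m + 1) (by omega) (by omega) hKJ (by omega)
        (by omega)
      rw [show t + (m + 1) - 1 = τ + 1 by omega] at hr
      have hn : ¬ (t ≤ τ + 1 ∧ τ + 1 + 1 - t ≤ #((Jᶜ ∪ K) ∩ J) ∧ i ∈ M (τ + 1)) := by
        rw [compl_union_inter hKJ]
        omega
      exact tie hr (some_mem_of_notMem hj (by simp [hj]) hn) (none_mem_of_not hn)
  · by_cases hlt : τ + 1 < t
    · by_cases hj : j ∈ J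
      · exact tie (H.reach_singleton hj hlt) (some_mem_of_lt (by simp) hlt)
          (none_mem_of_not (by omega))
      · exact tie (H.reach_singleton hj₀ hlt) (some_mem_of_lt (by simp [hj]) hlt)
          (none_mem_of_not (by omega))
    · have hr := H.reach_univ (τ := τ + 1) (by omega) hτ
      have hn : ¬ (t ≤ τ + 1 ∧ τ + 1 + 1 - t ≤ #(univ ∩ J) ∧ i ∈ M (τ + 1)) := by
        rw [H.card_univ_inter]
        omega
      by_cases hj : j ∈ J
      · exact tie hr (H.some_mem_of_le (by omega) (mem_univ j) hj H.card_univ_inter)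
          (none_mem_of_not hn)
      · exact tie hr (some_mem_of_notMem hj (mem_univ j) hn) (none_mem_of_not hn)

theorem face_nonempty :
    {z ∈ Q N V n | pairing n (coeff n h r t J M) z = optValue n h r t J n univ}.Nonempty := by
  exact ⟨pointOf n (optActions n h r t J M),
    pointOf_mem H.n_pos H.card_V H.optActions_nonempty,
    pairing_pointOf_of_tight H.card_V H.optActions_nonempty H.mem_of_some_mem H.optValue_zero
      (fun τ S i α hα => (mem_filter.1 hα).2) H.optValue_eq_average⟩

theorem isFacetDefining :
    IsFacetDefining (Q N V n) (pairing n (coeff n h r t J M)) (optValue n h r t J n univ) := by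
  have hn := H.n_pos
  have h1 := H.one_le_h
  have ht := H.one_le_t
  have htn := H.add_le
  obtain ⟨i₁, hi₁⟩ := H.M_nonempty (τ := t) le_rfl (by omega)
  obtain ⟨j₀, hj₀⟩ := card_pos.1 (show 0 < #J by rw [H.card_J]; exact h1)
  have hcoeff : coeff n h r t J M t i₁ j₀ ≠ 0 := by
    rw [coeff, if_pos hj₀, if_neg (by omega), if_pos ⟨le_rfl, hi₁⟩]
    have : (n : ℝ) ≠ 0 := by exact_mod_cast hn.ne'
    exact pow_ne_zero _ this
  refine isFacetDefining_of_dual ?_ (fun z hz => H.pairing_le hz) H.face_nonempty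
    (eq_zero_of_const_on_Q hn H.card_N H.card_V) ?_
  · intro h0
    have := pairing_single (coeff n h r t J M) i₁ j₀
      (⟨t, Finset.mem_Icc.2 ⟨ht, by omega⟩⟩ : Stage n)
    rw [h0] at this
    exact hcoeff this.symm
  · intro ψ hψ
    obtain ⟨c, rfl⟩ := exists_eq_pairing ψ
    -- Makes c - l · `coeff` vanish at (t, i₁, j₀); it is still constant on the face, where the
    -- reward of `coeff` is constant.
    set l := c t i₁ j₀ / coeff n h r t J M t i₁ j₀ with hl
    have hsub : ∀ z : MatchSpace N V n,
        pairing n (fun τ i j => c τ i j - l * coeff n h r t J M τ i j) z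
          = pairing n c z - l * pairing n (coeff n h r t J M) z := by
      intro z
      rw [pairing_apply, pairing_apply, pairing_apply, mul_sum, ← sum_sub_distrib]
      refine sum_congr rfl fun _ _ => ?_
      rw [mul_sum, ← sum_sub_distrib]
      refine sum_congr rfl fun _ _ => ?_
      rw [mul_sum, ← sum_sub_distrib]
      exact sum_congr rfl fun _ _ => by ring
    have key := H.coeff_eq_zero (c := fun τ i j => c τ i j - l * coeff n h r t J M τ i j)
      (fun z hz z' hz' => by rw [hsub, hsub, hψ z hz z' hz', hz.2, hz'.2]) hi₁ hj₀
      (by rw [hl, div_mul_cancel₀ _ hcoeff, sub_self])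
    refine ⟨l, ?_⟩
    rw [pairing_congr (d := fun τ i j => l * coeff n h r t J M τ i j)]
    · refine LinearMap.ext fun z => ?_
      simp only [pairing_apply, LinearMap.smul_apply, smul_eq_mul, mul_sum, mul_assoc]
    · intro τ hτ i j
      rw [Finset.mem_Icc] at hτ
      obtain ⟨k, rfl⟩ : ∃ k, τ = k + 1 := ⟨τ - 1, by omega⟩
      exact sub_eq_zero.1 (key k (by omega) i j)

theorem optValue_start :
    optValue n h r t J n univ = r + ∑ τ ∈ Finset.Icc 1 (h - 1), (n : ℝ) ^ τ := by
  have h1 := H.one_le_h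
  have htn := H.add_le
  rw [optValue, H.card_univ_inter, min_eq_right (by omega)]
  obtain ⟨k, rfl⟩ : ∃ k, h = k + 1 := ⟨h - 1, by omega⟩
  rw [total_succ, marginal, if_neg (lt_irrefl _), add_comm, total, ← sum_range_reflect,
    Nat.add_sub_cancel, sum_congr rfl fun l hl => ?_,
    ← sum_stage (n := k) (fun τ => (n : ℝ) ^ τ), Finset.sum_coe_sort (Finset.Icc 1 k) fun τ => (n : ℝ) ^ τ]
  have := mem_range.1 hl
  rw [marginal, if_pos (by omega)]
  congr 1
  omega

end IsFacetData

/-! ### From coefficients to the stated inequality -/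

theorem sum_coeff {τ : ℕ} (hτ : τ ∈ Finset.Icc 1 n) (z : MatchSpace N V n) :
    ∑ i, ∑ j, coeff n h r t J M τ i j * z i j ⟨τ, hτ⟩
      = if t + h ≤ τ then r * Z z univ J τ else
        if t ≤ τ then (n : ℝ) ^ (t + h - τ) * Z z (M τ) J τ else 0 := by
  have hJ : ∀ i, ∑ j, coeff n h r t J M τ i j * z i j ⟨τ, hτ⟩
      = (if t + h ≤ τ then (r : ℝ) else if t ≤ τ ∧ i ∈ M τ then (n : ℝ) ^ (t + h - τ) else 0)
        * ∑ j ∈ J, z i j ⟨τ, hτ⟩ := by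
    intro i
    simp_rw [coeff, ite_mul _ _ (0 : ℝ) (z i _ _), zero_mul]
    rw [← sum_filter, filter_mem_eq_inter, univ_inter, mul_sum]
  simp_rw [hJ, Z, dif_pos hτ]
  split_ifs with h1 h2
  · rw [mul_sum]
  · simp_rw [h2, true_and, ite_mul, zero_mul]
    rw [← sum_filter, filter_mem_eq_inter, univ_inter, mul_sum]
  · simp [h2]

theorem pairing_coeff (ht : 1 ≤ t) (hh : 1 ≤ h) (htn : t + h ≤ n) (z : MatchSpace N V n) :
    pairing n (coeff n h r t J M) z = r * ∑ τ ∈ Finset.Icc (t + h) n, Z z univ J τ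
      + ∑ τ ∈ Finset.Ico t (t + h), (n : ℝ) ^ (t + h - τ) * Z z (M τ) J τ := by
  rw [pairing_apply, sum_congr rfl fun τ _ => sum_coeff (h := h) (r := r) (t := t) (J := J) (M := M) τ.2 z,
    Finset.sum_coe_sort (Finset.Icc 1 n) fun τ => if t + h ≤ τ then r * Z z univ J τ else
        if t ≤ τ then (n : ℝ) ^ (t + h - τ) * Z z (M τ) J τ else 0, sum_ite, mul_sum, ← sum_filter]
  congr 1
  · refine sum_congr ?_ fun _ _ => rfl
    ext τ
    simp only [mem_filter, Finset.mem_Icc]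
    omega
  · refine sum_congr ?_ fun _ _ => rfl
    ext τ
    simp only [mem_filter, Finset.mem_Icc, Finset.mem_Ico]
    omega

end Facet

end OBM

theorem mainTheorem5 {N V : Type*} [Fintype N] [Fintype V] [DecidableEq V] (n : ℕ)
    (hN : Fintype.card N = n) (hV : Fintype.card V = n)
    (h r t : ℕ) (hh : h ∈ Finset.Icc 1 (n - 1)) (hr : r ∈ Finset.Icc 1 (n - 1))
    (ht : t ∈ Finset.Icc 1 (n - h)) (hhr : 2 ≤ h ∨ r = 1)
    (J : Finset V) (hJ : J.card = h) (I : Finset N) (hI : I.card = r) (i : ℕ → N) :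
    OBM.IsFacetDefining (OBM.Q N V n)
      (fun z =>
        (r : ℝ) * ∑ τ ∈ Finset.Icc (t + h) n, OBM.Z z Finset.univ J τ
          + (n : ℝ) * OBM.Z z I J (t + h - 1)
          + ∑ τ ∈ Finset.Ico t (t + h - 1), (n : ℝ) ^ (t + h - τ) * OBM.Z z {i τ} J τ)
      ((r : ℝ) + ∑ τ ∈ Finset.Icc 1 (h - 1), (n : ℝ) ^ τ) := by
  classical
  rw [Finset.mem_Icc] at hh hr ht
  -- The set I takes the place of a singleton in stage t + h - 1, where the power n^(t+h-τ) is n.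
  have H : OBM.IsFacetData n h r t J (fun τ => if τ = t + h - 1 then I else {i τ}) :=
    { card_N := hN
      card_V := hV
      one_le_h := hh.1
      one_le_r := hr.1
      r_lt := by omega
      one_le_t := ht.1
      add_le := by omega
      two_le_or := hhr
      card_J := hJ
      card_M := fun τ _ h2 => by rw [if_neg (by omega), Finset.card_singleton]
      card_M_last := by rw [if_pos rfl, hI] }
  have key := H.isFacetDefining
  rw [H.optValue_start] at key
  convert key using 1
  funext z
  rw [OBM.pairing_coeff ht.1 hh.1 H.add_le, add_assoc, add_right_inj]
  obtain ⟨m, hm⟩ : ∃ m, t + h = m + 1 := ⟨t + h - 1, by omega⟩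
  rw [hm, Finset.sum_Ico_succ_top (by omega), Nat.add_sub_cancel, if_pos rfl, add_comm,
    show m + 1 - m = 1 by omega, pow_one, add_left_inj]
  refine Finset.sum_congr rfl fun τ hτ => ?_
  rw [if_neg (Finset.mem_Ico.1 hτ).2.ne]
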